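/- Let $\mathbb{T}$ be the countable discrete space of all finite unlabeled rooted trees (isomorphism classes, under root-preserving graph isomorphism, of finite trees with a distinguished vertex), and let $\mathbb{T}_\ast=\mathbb{T}\sqcup\{\ast\}$, also discrete; equip $\mathbb{T}^\infty$ and $\mathbb{T}_\ast^\infty$ with the product topologies. For $\mathbf{t}\in\mathbb{T}$ with root $\rho$ and a vertex $v$ of $\mathbf{t}$, let $v=v_0,v_1,\dots,v_h=\rho$ be the path from $v$ to the root, let $t_0$ be the subtree rooted at $v_0$ consisting of all vertices whose path to the root passes through $v_0$, and for $1\le k\le h$ let $t_k$ be the subtree rooted at $v_k$ consisting of all vertices whose path to the root passes through $v_k$ but not through $v_{k-1}$. Let $\Phi(\mathbf{t},\cdot)$ be the law on $\mathbb{T}_\ast^\infty$ of $(t_0,t_1,\dots,t_h,\ast,\ast,\dots)$ when $v$ is chosen uniformly from the vertices of $\mathbf{t}$. A $\mathtt{sin}$-tree is an element of $\mathbb{T}^\infty\subset\mathbb{T}_\ast^\infty$, and a sequence $(\mathcal{T}_n)_{n\ge1}$ of random elements of $\mathbb{T}$ converges in the probability fringe sense to a $\mathbb{T}^\infty$-valued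 random variable $\mathcal{T}$ if the random probability measures $\Phi(\mathcal{T}_n,\cdot)$ converge in distribution to the (deterministic) law of $\mathcal{T}$, in the topology of weak convergence of probability measures on $\mathbb{T}_\ast^\infty$. **Theorem.** Suppose that $(\mathcal{T}_n)_{n=1}^\infty$ is a sequence of random finite unlabeled rooted trees that converges in the probability fringe sense to a (random) $\mathtt{sin}$-tree $\mathcal{T}$. Let $F_n$ denote the spectral distribution of the adjacency matrix of $\mathcal{T}_n$, that is, the uniform distribution on its eigenvalues counted with multiplicity. Then there exists a deterministic probability distribution $F$ on $\mathbb{R}$ (which may depend on the model) such that the random probability measures $F_n$ converge in distribution to $F$ in the topology of weak convergence of probability measures on $\mathbb{R}$. -/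

import Mathlib

open MeasureTheory ProbabilityTheory Filter Topology
open scoped ENNReal

/-! ### Finite unlabeled rooted trees -/

/-- A finite labeled rooted tree: a graph on `{0, …, size - 1}` that is a tree, with a
distinguished vertex. -/
structure LabeledRootedTree : Type where
  size : ℕ
  graph : SimpleGraph (Fin size)
  isTree : graph.IsTree
  root : Fin size

namespace LabeledRootedTree

/-- Two rooted trees are identified when there is a root-preserving graph isomorphism. -/
def Isom (t s : LabeledRootedTree) : Prop :=
  ∃ e : t.graph ≃g s.graph, e t.root = s.root

instance setoid : Setoid LabeledRootedTree where
  r := Isom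
  iseqv :=
    { refl := fun _ => ⟨SimpleGraph.Iso.refl, rfl⟩
      symm := fun {t s} ⟨e, he⟩ => ⟨e.symm, by
        rw [← he]; exact e.toEquiv.symm_apply_apply t.root⟩
      trans := fun {t s u} ⟨e, he⟩ ⟨f, hf⟩ => ⟨e.trans f, by
        rw [← hf, ← he]; rfl⟩ }

instance (t : LabeledRootedTree) : Nonempty (Fin t.size) := ⟨t.root⟩

instance : Countable LabeledRootedTree := by
  have hinj : Function.Injective
      (fun t : LabeledRootedTree => (⟨t.size, t.graph, t.root⟩ :
        Σ n : ℕ, SimpleGraph (Fin n) × Fin n)) := by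
    rintro ⟨n, G, h, r⟩ ⟨m, H, h', r'⟩ heq
    obtain ⟨rfl, hGr⟩ := Sigma.mk.inj_iff.1 heq
    obtain ⟨rfl, rfl⟩ := Prod.mk_inj.1 (eq_of_heq hGr)
    rfl
  exact hinj.countable

end LabeledRootedTree

/-- The space of finite unlabeled rooted trees: isomorphism classes of finite rooted trees. -/
def UTree : Type := Quotient LabeledRootedTree.setoid

namespace UTree

instance : Countable UTree := inferInstanceAs (Countable (Quotient LabeledRootedTree.setoid))
instance : TopologicalSpace UTree := ⊥
instance : DiscreteTopology UTree := ⟨rfl⟩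
instance : MeasurableSpace UTree := ⊤
instance : DiscreteMeasurableSpace UTree := ⟨fun _ => trivial⟩

/-- The isomorphism class of a rooted tree with an arbitrary finite vertex set. -/
noncomputable def ofGraph {V : Type*} [Fintype V] (G : SimpleGraph V) (hG : G.IsTree) (r : V) :
    UTree :=
  Quotient.mk LabeledRootedTree.setoid
    { size := Fintype.card V
      graph := G.overFin rfl
      isTree := (G.overFinIso rfl).isTree_iff.1 hG
      root := G.overFinIso rfl r }

lemma ofGraph_eq {V W : Type*} [Fintype V] [Fintype W] {G : SimpleGraph V} {H : SimpleGraph W}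
    (hG : G.IsTree) (hH : H.IsTree) {r : V} {s : W} (e : G ≃g H) (he : e r = s) :
    ofGraph G hG r = ofGraph H hH s := by
  refine Quotient.sound ⟨((G.overFinIso rfl).symm.trans e).trans (H.overFinIso rfl), ?_⟩
  subst he
  simp

end UTree

/-- The space of finite unlabeled rooted trees with an adjoined point `∗`, here `none`. -/
def UTreeStar : Type := Option UTree

namespace UTreeStar

instance : Countable UTreeStar := inferInstanceAs (Countable (Option UTree))
instance : TopologicalSpace UTreeStar := ⊥
instance : DiscreteTopology UTreeStar := ⟨rfl⟩
instance : MeasurableSpace UTreeStar := ⊤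
instance : DiscreteMeasurableSpace UTreeStar := ⟨fun _ => trivial⟩

/-- The inclusion of the trees in the trees with a point adjoined. -/
def ofUTree (t : UTree) : UTreeStar := some t

/-- The adjoined point. -/
def star : UTreeStar := (none : Option UTree)

end UTreeStar

/-! ### Decomposition of a tree along the path from a vertex to the root -/

namespace TreePath

variable {V W : Type*} {G : SimpleGraph V} {H : SimpleGraph W}

/-- The unique path from `v` to the root `r`. -/
noncomputable def toRoot (hG : G.IsTree) (r v : V) : G.Walk v r :=
  (hG.existsUnique_path v r).choose

lemma toRoot_isPath (hG : G.IsTree) (r v : V) : (toRoot hG r v).IsPath :=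
  (hG.existsUnique_path v r).choose_spec.1

lemma eq_toRoot (hG : G.IsTree) (r v : V) {p : G.Walk v r} (hp : p.IsPath) :
    p = toRoot hG r v :=
  (hG.existsUnique_path v r).choose_spec.2 p hp

/-- Writing `v = v₀, v₁, …, v_h = r` for the path from `v` to the root `r`, the vertex set of the
`k`-th tree hanging off this path: for `k = 0`, the vertices whose path to the root passes through
`v₀`; for `k ≥ 1`, those whose path to the root passes through `v_k` but not `v_{k-1}`.
(Only meaningful for `k ≤ h`.) -/
def hangingSet (hG : G.IsTree) (r v : V) : ℕ → Set V
  | 0 => {w | v ∈ (toRoot hG r w).support}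
  | k + 1 => {w | (toRoot hG r v).getVert (k + 1) ∈ (toRoot hG r w).support ∧
      (toRoot hG r v).getVert k ∉ (toRoot hG r w).support}

lemma toRoot_getVert (hG : G.IsTree) (r v : V) (k : ℕ) :
    toRoot hG r ((toRoot hG r v).getVert k) = (toRoot hG r v).drop k :=
  (eq_toRoot hG r _ ((toRoot_isPath hG r v).drop k)).symm

lemma mem_hangingSet (hG : G.IsTree) (r v : V) {k : ℕ} (hk : k ≤ (toRoot hG r v).length) :
    (toRoot hG r v).getVert k ∈ hangingSet hG r v k := by
  cases k with
  | zero => simp [hangingSet]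
  | succ k =>
    refine ⟨SimpleGraph.Walk.start_mem_support _, ?_⟩
    rw [toRoot_getVert]
    intro hmem
    obtain ⟨n, hn, hn'⟩ := SimpleGraph.Walk.mem_support_iff_exists_getVert.1 hmem
    rw [SimpleGraph.Walk.drop_getVert] at hn
    rw [SimpleGraph.Walk.drop_length] at hn'
    have := (toRoot_isPath hG r v).getVert_injOn (by rw [Set.mem_ofPred]; lia)
      (by rw [Set.mem_ofPred]; lia) hn
    lia

lemma toRoot_support_subset (hG : G.IsTree) (r w u : V) (hu : u ∈ (toRoot hG r w).support) :
    (toRoot hG r u).support ⊆ (toRoot hG r w).support := by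
  classical
  rw [← eq_toRoot hG r u ((toRoot_isPath hG r w).dropUntil hu)]
  exact SimpleGraph.Walk.support_dropUntil_subset_support _ hu

/-- Every vertex on the initial segment of the path from `w` to the root that ends at `x` still
has `x` on its own path to the root. -/
lemma mem_support_of_mem_takeUntil [DecidableEq V] (hG : G.IsTree) (r w x u : V)
    (hx : x ∈ (toRoot hG r w).support) (hu : u ∈ ((toRoot hG r w).takeUntil x hx).support) :
    x ∈ (toRoot hG r u).support := by
  have hp := toRoot_isPath hG r w
  set p := toRoot hG r w with hpdef
  have hq : ((((p.takeUntil x hx).dropUntil u hu).append (p.dropUntil x hx))).IsPath := by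
    have h2 : ((p.takeUntil x hx).takeUntil u hu).append
        (((p.takeUntil x hx).dropUntil u hu).append (p.dropUntil x hx)) = p := by
      rw [SimpleGraph.Walk.append_assoc, SimpleGraph.Walk.take_spec,
        SimpleGraph.Walk.take_spec]
    rw [← h2] at hp
    exact hp.of_append_right
  rw [← eq_toRoot hG r u hq, SimpleGraph.Walk.mem_support_append_iff]
  exact Or.inr (SimpleGraph.Walk.start_mem_support _)

lemma hangingSet_isTree (hG : G.IsTree) (r v : V) {k : ℕ}
    (hk : k ≤ (toRoot hG r v).length) : (G.induce (hangingSet hG r v k)).IsTree := by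
  classical
  refine ⟨?_, hG.isAcyclic.induce _⟩
  have hmem := mem_hangingSet hG r v hk
  rw [SimpleGraph.connected_iff_exists_forall_reachable]
  refine ⟨⟨_, hmem⟩, ?_⟩
  rintro ⟨w, hw⟩
  have hx : (toRoot hG r v).getVert k ∈ (toRoot hG r w).support := by
    cases k with
    | zero => simpa [hangingSet] using hw
    | succ k => exact hw.1
  have hall : ∀ u ∈ ((toRoot hG r w).takeUntil _ hx).support, u ∈ hangingSet hG r v k := by
    intro u hu
    have h1 := mem_support_of_mem_takeUntil hG r w _ u hx hu
    have h2 := toRoot_support_subset hG r w u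
      (SimpleGraph.Walk.support_takeUntil_subset_support _ hx hu)
    cases k with
    | zero => simpa [hangingSet] using h1
    | succ k => exact ⟨h1, fun h3 => hw.2 (h2 h3)⟩
  exact ⟨(((toRoot hG r w).takeUntil _ hx).induce _ hall).reverse⟩

open Classical in
/-- The sequence `(t₀, t₁, …, t_h, ∗, ∗, …)` associated with the vertex `v`, where
`v = v₀, v₁, …, v_h = r` is the path from `v` to the root and `t_k` is the `k`-th tree hanging off
this path, rooted at `v_k`. -/
noncomputable def fringe [Fintype V] (hG : G.IsTree) (r v : V) : ℕ → UTreeStar := fun k =>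
  if hk : k ≤ (toRoot hG r v).length then
    UTreeStar.ofUTree (UTree.ofGraph (G.induce (hangingSet hG r v k)) (hangingSet_isTree hG r v hk)
      ⟨(toRoot hG r v).getVert k, mem_hangingSet hG r v hk⟩)
  else UTreeStar.star

lemma toRoot_map (hG : G.IsTree) (hH : H.IsTree) (e : G ≃g H) (r v : V) :
    toRoot hH (e r) (e v) = (toRoot hG r v).map e.toHom :=
  (eq_toRoot hH (e r) (e v)
    ((toRoot_isPath hG r v).map e.injective)).symm

lemma getVert_map (hG : G.IsTree) (hH : H.IsTree) (e : G ≃g H) (r v : V) (k : ℕ) :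
    (toRoot hH (e r) (e v)).getVert k = e ((toRoot hG r v).getVert k) := by
  rw [toRoot_map hG hH e, SimpleGraph.Walk.getVert_map]; rfl

lemma mem_support_map (hG : G.IsTree) (hH : H.IsTree) (e : G ≃g H) (r u w : V) :
    e u ∈ (toRoot hH (e r) (e w)).support ↔ u ∈ (toRoot hG r w).support := by
  rw [toRoot_map hG hH e, SimpleGraph.Walk.support_map]
  exact List.mem_map_of_injective e.injective

lemma mem_hangingSet_map (hG : G.IsTree) (hH : H.IsTree) (e : G ≃g H) (r v w : V) (k : ℕ) :
    e w ∈ hangingSet hH (e r) (e v) k ↔ w ∈ hangingSet hG r v k := by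
  cases k with
  | zero => exact mem_support_map hG hH e r v w
  | succ k =>
    simp only [hangingSet, Set.mem_ofPred_eq, getVert_map hG hH e, mem_support_map hG hH e]

lemma fringe_map [Fintype V] [Fintype W] (hG : G.IsTree) (hH : H.IsTree) (e : G ≃g H) (r v : V) :
    fringe hH (e r) (e v) = fringe hG r v := by
  classical
  funext k
  have hlen : (toRoot hH (e r) (e v)).length = (toRoot hG r v).length := by
    rw [toRoot_map hG hH e, SimpleGraph.Walk.length_map]
  unfold fringe
  by_cases hk : k ≤ (toRoot hG r v).length
  · rw [dif_pos hk, dif_pos (hlen ▸ hk)]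
    congr 1
    have hb : Set.BijOn e (hangingSet hG r v k) (hangingSet hH (e r) (e v) k) := by
      refine ⟨fun w hw => (mem_hangingSet_map hG hH e r v w k).2 hw, e.injective.injOn, ?_⟩
      intro w hw
      obtain ⟨w, rfl⟩ := e.surjective w
      exact ⟨w, (mem_hangingSet_map hG hH e r v w k).1 hw, rfl⟩
    have hk' : k ≤ (toRoot hH (e r) (e v)).length := hlen ▸ hk
    have he : (e.induce hb) ⟨(toRoot hG r v).getVert k, mem_hangingSet hG r v hk⟩ =
        ⟨(toRoot hH (e r) (e v)).getVert k, mem_hangingSet hH (e r) (e v) hk'⟩ :=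
      Subtype.ext (getVert_map hG hH e r v k).symm
    exact (UTree.ofGraph_eq (hangingSet_isTree hG r v hk) (hangingSet_isTree hH _ _ hk')
      (e.induce hb) he).symm
  · rw [dif_neg hk, dif_neg (hlen ▸ hk)]

end TreePath

/-! ### Empirical distributions -/

/-- The empirical distribution `(#ι)⁻¹ ∑ᵢ δ_{f i}` of a nonempty finite family of points. -/
noncomputable def empiricalDist {ι X : Type*} [Fintype ι] [Nonempty ι] [MeasurableSpace X]
    (f : ι → X) : ProbabilityMeasure X :=
  ⟨(Fintype.card ι : ℝ≥0∞)⁻¹ • ∑ i, Measure.dirac (f i), ⟨by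
    simp [ENNReal.inv_mul_cancel]⟩⟩

lemma empiricalDist_eq {ι κ X : Type*} [Fintype ι] [Nonempty ι] [Fintype κ] [Nonempty κ]
    [MeasurableSpace X] {f : ι → X} {g : κ → X}
    (h : Finset.univ.val.map f = Finset.univ.val.map g) :
    empiricalDist f = empiricalDist g := by
  have hcard : Fintype.card ι = Fintype.card κ := by
    simpa using congrArg Multiset.card h
  have hsum : ∑ i, Measure.dirac (f i) = ∑ j, Measure.dirac (g j) := by
    have := congrArg (fun s => (s.map Measure.dirac).sum) h
    simp only [Multiset.map_map] at this
    exact this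
  refine Subtype.ext ?_
  change (Fintype.card ι : ℝ≥0∞)⁻¹ • ∑ i, Measure.dirac (f i) =
    (Fintype.card κ : ℝ≥0∞)⁻¹ • ∑ j, Measure.dirac (g j)
  rw [hcard, hsum]

lemma empiricalDist_comp_equiv {ι κ X : Type*} [Fintype ι] [Nonempty ι] [Fintype κ] [Nonempty κ]
    [MeasurableSpace X] {f : ι → X} {g : κ → X} (e : ι ≃ κ) (h : ∀ i, g (e i) = f i) :
    empiricalDist f = empiricalDist g := by
  refine empiricalDist_eq ?_
  have hfg : f = g ∘ e := funext fun i => (h i).symm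
  rw [hfg, ← Multiset.map_map, ← Equiv.coe_toEmbedding, ← Finset.map_val, Finset.map_univ_equiv]

/-! ### The fringe kernel and the spectral distribution -/

namespace LabeledRootedTree

/-- The fringe distribution of a labeled rooted tree. -/
noncomputable def fringeDist (t : LabeledRootedTree) : ProbabilityMeasure (ℕ → UTreeStar) :=
  empiricalDist (TreePath.fringe t.isTree t.root)

open Classical in
/-- The spectral distribution of a labeled rooted tree: the empirical distribution of the
eigenvalues, counted with multiplicity, of its adjacency matrix. -/
noncomputable def spectralDist (t : LabeledRootedTree) : ProbabilityMeasure ℝ :=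
  empiricalDist (t.graph.isHermitian_adjMatrix ℝ).eigenvalues

lemma fringeDist_eq_of_isom {t s : LabeledRootedTree} (h : Isom t s) : t.fringeDist = s.fringeDist := by
  obtain ⟨e, he⟩ := h
  refine empiricalDist_comp_equiv e.toEquiv fun v => ?_
  rw [← he]
  exact TreePath.fringe_map t.isTree s.isTree e t.root v

lemma spectralDist_eq_of_isom {t s : LabeledRootedTree} (h : Isom t s) :
    t.spectralDist = s.spectralDist := by
  classical
  obtain ⟨e, -⟩ := h
  refine empiricalDist_eq ?_
  have h1 := (t.graph.isHermitian_adjMatrix ℝ).roots_charpoly_eq_eigenvalues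
  have h2 := (s.graph.isHermitian_adjMatrix ℝ).roots_charpoly_eq_eigenvalues
  have h3 : (t.graph.adjMatrix ℝ).charpoly = (s.graph.adjMatrix ℝ).charpoly := by
    rw [← Matrix.charpoly_reindex e.toEquiv]
    congr 1
    ext i j
    obtain ⟨i, rfl⟩ := e.surjective i
    obtain ⟨j, rfl⟩ := e.surjective j
    have hi : e.toEquiv.symm (e i) = i := e.toEquiv.symm_apply_apply i
    have hj : e.toEquiv.symm (e j) = j := e.toEquiv.symm_apply_apply j
    simp only [Matrix.reindex_apply, Matrix.submatrix_apply, SimpleGraph.adjMatrix_apply,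
      e.map_adj_iff, hi, hj]
  rw [h3, h2] at h1
  exact h1.symm

end LabeledRootedTree

namespace UTree

/-- The probability kernel `Φ(t, ·)`: the distribution of the sequence
`(t₀, t₁, …, t_h, ∗, ∗, …)` associated with a uniformly chosen vertex of `t`. -/
noncomputable def fringeDist (t : UTree) : ProbabilityMeasure (ℕ → UTreeStar) :=
  Quotient.lift LabeledRootedTree.fringeDist (fun _ _ h => LabeledRootedTree.fringeDist_eq_of_isom h) t

/-- The spectral distribution of the adjacency matrix of an unlabeled tree. -/
noncomputable def spectralDist (t : UTree) : ProbabilityMeasure ℝ :=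
  Quotient.lift LabeledRootedTree.spectralDist (fun _ _ h => LabeledRootedTree.spectralDist_eq_of_isom h) t

end UTree

/-! ### Modes of convergence -/

/-- The random probability measures `Y n` on `E`, defined on probability spaces
`(Ω n, P n)`, converge in distribution to the deterministic probability measure `ν`, as random
elements of the space of probability measures on `E` with the topology of weak convergence and
its Borel σ-algebra. -/
def ConvergesInDistributionTo {E : Type*} [TopologicalSpace E] [MeasurableSpace E]
    [OpensMeasurableSpace E] {Ω : ℕ → Type*} [∀ n, MeasurableSpace (Ω n)]
    (P : ∀ n, Measure (Ω n)) [∀ n, IsProbabilityMeasure (P n)]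
    (Y : ∀ n, Ω n → ProbabilityMeasure E) (ν : ProbabilityMeasure E) : Prop :=
  letI : MeasurableSpace (ProbabilityMeasure E) := borel _
  haveI : BorelSpace (ProbabilityMeasure E) := ⟨rfl⟩
  TendstoInDistribution Y atTop (fun _ : Unit => ν) P (Measure.dirac ())

/-- The law, on sequences in the trees with a point adjoined, of a random sequence of finite
unlabeled rooted trees. -/
noncomputable def sinTreeLaw {Ω : Type*} [MeasurableSpace Ω] (P : Measure Ω)
    [IsProbabilityMeasure P] (T : Ω → ℕ → UTree) (hT : Measurable T) :
    ProbabilityMeasure (ℕ → UTreeStar) :=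
  ⟨P.map (fun ω k => UTreeStar.ofUTree (T ω k)), Measure.isProbabilityMeasure_map
    (measurable_pi_lambda _ fun k =>
      (measurable_of_countable UTreeStar.ofUTree).comp
        ((measurable_pi_apply k).comp hT)).aemeasurable⟩

/-- Probability fringe convergence of the random trees `T n` to the random sequence of finite
trees (`sin`-tree) `S`. -/
def ConvergesInFringe {Ω : ℕ → Type*} [∀ n, MeasurableSpace (Ω n)]
    (P : ∀ n, Measure (Ω n)) [∀ n, IsProbabilityMeasure (P n)] (T : ∀ n, Ω n → UTree)
    {Ω' : Type*} [MeasurableSpace Ω'] (P' : Measure Ω') [IsProbabilityMeasure P']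
    (S : Ω' → ℕ → UTree) (hS : Measurable S) : Prop :=
  ConvergesInDistributionTo P (fun n ω => (T n ω).fringeDist) (sinTreeLaw P' S hS)

/-! ### Counting eigenvalues of graphs -/

namespace Matrix

variable {n : Type*} [Fintype n] [DecidableEq n] {A : Matrix n n ℝ}

/-! Fix `x` and count the eigenvalues at most `x`. By Cauchy interlacing
(`eigCount_induce_compl_le`), deleting the root of a tree lowers this count by 0 or 1, the defect of
the rooted tree at `x`. What remains is the disjoint union of the subtrees at the children, and
counts add over disjoint unions. Iterating, the count is the sum over all vertices `u` of the defect
of the subtree of descendants of `u` (`TreePath.eigCount_eq_sum`).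

That subtree is the entry `t₀` of the fringe sequence, so the spectral distribution function at `x`
is the fringe probability that `t₀` has defect 1 (`UTree.spectralDist_Iic`). This event is clopen,
so weak convergence of the fringe laws gives convergence for every `x`. The limit is a distribution
function by dominated convergence: the defect of a fixed finite tree is 0 near `-∞`, 1 near `+∞` and
locally constant to the right, and under the limit law `t₀` is almost surely a finite tree. Since
the fringe limit is deterministic, so is the spectral one. -/

lemma toQuadraticForm'_apply (M : Matrix n n ℝ) (v : n → ℝ) :
    M.toQuadraticForm' v = v ⬝ᵥ (M *ᵥ v) := by
  simp [toQuadraticForm', LinearMap.BilinMap.toQuadraticMap_apply, toLinearMap₂'_apply']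

/-- Shifting by `x` and diagonalizing turns the quadratic form of a symmetric matrix into a weighted
sum of squares. -/
lemma IsHermitian.toQuadraticForm'_sub_equivalent (hA : A.IsHermitian) (x : ℝ) :
    ((A - x • (1 : Matrix n n ℝ)).toQuadraticForm').Equivalent
      (QuadraticMap.weightedSumSquares ℝ fun i => hA.eigenvalues i - x) := by
  set U : Matrix n n ℝ := (hA.eigenvectorUnitary : Matrix n n ℝ) with hU
  have h1 : U * Uᵀ = 1 := by
    simpa [star_eq_conjTranspose] using Unitary.coe_mul_star_self hA.eigenvectorUnitary
  have h2 : Uᵀ * U = 1 := by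
    simpa [star_eq_conjTranspose] using Unitary.coe_star_mul_self hA.eigenvectorUnitary
  have h3 : A = U * diagonal hA.eigenvalues * Uᵀ := by
    simpa [Unitary.conjStarAlgAut_apply, star_eq_conjTranspose, Function.comp_def] using
      hA.spectral_theorem
  have h4 : A - x • (1 : Matrix n n ℝ) =
      U * diagonal (fun i => hA.eigenvalues i - x) * Uᵀ := by
    have : diagonal (fun i => hA.eigenvalues i - x) =
        diagonal hA.eigenvalues - x • (1 : Matrix n n ℝ) := by
      ext i j
      by_cases h : i = j <;> simp [h]
    rw [this, mul_sub, sub_mul, ← h3]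
    simp [h1]
  -- The change of coordinates is `v ↦ Uᵀ v`, into the eigenbasis.
  refine ⟨⟨toLin'OfInv h1 h2, fun v => ?_⟩⟩
  rw [QuadraticMap.weightedSumSquares_apply, toQuadraticForm'_apply, h4]
  have : v ⬝ᵥ (U * diagonal (fun i => hA.eigenvalues i - x) * Uᵀ) *ᵥ v =
      (Uᵀ *ᵥ v) ⬝ᵥ (diagonal (fun i => hA.eigenvalues i - x) *ᵥ (Uᵀ *ᵥ v)) := by
    rw [← mulVec_mulVec, ← mulVec_mulVec, dotProduct_mulVec, mulVec_transpose]
  rw [this]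
  simp only [dotProduct, mulVec_diagonal, smul_eq_mul]
  refine Finset.sum_congr rfl fun i _ => ?_
  change _ * ((Uᵀ *ᵥ v) i * (Uᵀ *ᵥ v) i) = _
  ring

/-- By Sylvester's law of inertia, the positive index of `A - x` is the number of eigenvalues above
`x`. -/
lemma IsHermitian.card_eigenvalues_le_add_sigPos (hA : A.IsHermitian) (x : ℝ) :
    {i | hA.eigenvalues i ≤ x}.ncard + sigPos (A - x • (1 : Matrix n n ℝ)).toQuadraticForm' =
      Fintype.card n := by
  rw [QuadraticForm.sigPos_of_equiv_weightedSumSquares (hA.toQuadraticForm'_sub_equivalent x),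
    ← Nat.card_eq_fintype_card, ← Set.ncard_add_ncard_compl {i | hA.eigenvalues i ≤ x}]
  congr 2
  ext i
  simp

end Matrix

/-! ### Index of inertia under restriction to a subspace -/

section Restriction

variable {M M' : Type*} [AddCommGroup M] [AddCommGroup M'] [Module ℝ M] [Module ℝ M']
  [FiniteDimensional ℝ M] [FiniteDimensional ℝ M'] {Q : QuadraticForm ℝ M}
  {Q' : QuadraticForm ℝ M'} {f : M' →ₗ[ℝ] M}

/-- The image under `f` of a positive definite subspace for `Q'` is positive definite for `Q`, of
the same dimension. -/
lemma sigPos_le_of_injective (hf : Function.Injective f) (h : ∀ v, Q (f v) = Q' v) :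
    sigPos Q' ≤ sigPos Q := by
  obtain ⟨V, hV, hpos⟩ := exists_finrank_eq_sigPos_and_posDef Q'
  rw [← hV, (V.equivMapOfInjective f hf).finrank_eq]
  refine le_sigPos_of_posDef Q ?_
  rintro ⟨_, v, hv, rfl⟩ hne
  have hv0 : (⟨v, hv⟩ : V) ≠ 0 := by
    rintro h0
    apply hne
    have : v = 0 := by simpa using h0
    simp [this]
  have := hpos ⟨v, hv⟩ hv0
  simpa [QuadraticMap.restrict_apply, h] using this

/-- Restricting a quadratic form to a subspace lowers its positive index of inertia by at most the
codimension. -/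
lemma sigPos_add_finrank_le_of_injective (hf : Function.Injective f) (h : ∀ v, Q (f v) = Q' v) :
    sigPos Q + Module.finrank ℝ M' ≤ sigPos Q' + Module.finrank ℝ M := by
  obtain ⟨V, hV, hpos⟩ := exists_finrank_eq_sigPos_and_posDef Q
  -- A maximal positive subspace for `Q` is cut down to the range of `f`; the dimension formula
  -- bounds what is lost by the codimension.
  have h1 : Module.finrank ℝ (V.comap f) ≤ sigPos Q' := by
    refine le_sigPos_of_posDef Q' ?_
    rintro ⟨v, hv⟩ hne
    have hv0 : (⟨f v, hv⟩ : V) ≠ 0 := by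
      intro h0
      apply hne
      have h1 : f v = 0 := by simpa using h0
      have : v = 0 := hf (by simpa using h1)
      simp [this]
    have := hpos ⟨f v, hv⟩ hv0
    simpa [QuadraticMap.restrict_apply, h] using this
  have h2 : Module.finrank ℝ (V.comap f) =
      Module.finrank ℝ (V ⊓ LinearMap.range f : Submodule ℝ M) := by
    rw [((V.comap f).equivMapOfInjective f hf).finrank_eq, Submodule.map_comap_eq, inf_comm]
  have h3 := Submodule.finrank_sup_add_finrank_inf_eq V (LinearMap.range f)
  have h4 := LinearMap.finrank_range_of_inj hf
  have h5 := Submodule.finrank_le (V ⊔ LinearMap.range f)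
  lia

end Restriction

/-! ### Eigenvalue counts: disjoint unions, interlacing, dependence on `x` -/

namespace SimpleGraph

variable {V W : Type*}

open Classical in
/-- The number of eigenvalues of the adjacency matrix, counted with multiplicity, that are at most
`x`. -/
noncomputable def eigCount [Finite V] (G : SimpleGraph V) (x : ℝ) : ℕ :=
  letI := Fintype.ofFinite V
  (G.adjMatrix ℝ).charpoly.roots.countP (· ≤ x)

lemma eigCount_eq [Fintype V] [DecidableEq V] (G : SimpleGraph V) [DecidableRel G.Adj] (x : ℝ) :
    G.eigCount x = (G.adjMatrix ℝ).charpoly.roots.countP (· ≤ x) := by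
  unfold eigCount
  congr!

/-- Roots of the characteristic polynomial suit block sums and isomorphisms; indexed eigenvalues
suit inertia and limits in `x`. This passes between the two. -/
lemma eigCount_eq_ncard [Fintype V] [DecidableEq V] (G : SimpleGraph V) [DecidableRel G.Adj]
    (x : ℝ) : G.eigCount x = {i | (G.isHermitian_adjMatrix ℝ).eigenvalues i ≤ x}.ncard := by
  rw [eigCount_eq, (G.isHermitian_adjMatrix ℝ).roots_charpoly_eq_eigenvalues,
    Multiset.countP_map, Set.ncard_eq_toFinset_card', Finset.card_def]
  congr 1
  simp

lemma Iso.eigCount_eq [Finite V] [Finite W] {G : SimpleGraph V} {H : SimpleGraph W} (e : G ≃g H)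
    (x : ℝ) : G.eigCount x = H.eigCount x := by
  classical
  have := Fintype.ofFinite V
  have := Fintype.ofFinite W
  rw [SimpleGraph.eigCount_eq, SimpleGraph.eigCount_eq, ← Matrix.charpoly_reindex e.toEquiv]
  congr 3
  ext i j
  obtain ⟨i, rfl⟩ := e.toEquiv.surjective i
  obtain ⟨j, rfl⟩ := e.toEquiv.surjective j
  have hij : H.Adj (e.toEquiv i) (e.toEquiv j) ↔ G.Adj i j := e.map_adj_iff
  rw [Matrix.reindex_apply, Matrix.submatrix_apply, e.toEquiv.symm_apply_apply,
    e.toEquiv.symm_apply_apply, adjMatrix_apply, adjMatrix_apply, if_congr hij.symm rfl rfl]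

/-- The adjacency matrix is block diagonal, so its characteristic polynomial factors. -/
lemma eigCount_sum [Finite V] [Finite W] (G : SimpleGraph V) (H : SimpleGraph W) (x : ℝ) :
    (G ⊕g H).eigCount x = G.eigCount x + H.eigCount x := by
  classical
  have := Fintype.ofFinite V
  have := Fintype.ofFinite W
  have h : (G ⊕g H).adjMatrix ℝ = Matrix.fromBlocks (G.adjMatrix ℝ) 0 0 (H.adjMatrix ℝ) := by
    ext (i | i) (j | j) <;> simp [adjMatrix_apply]
  rw [eigCount_eq, eigCount_eq, eigCount_eq, h, Matrix.charpoly_fromBlocks_zero₁₂,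
    Polynomial.roots_mul, Multiset.countP_add]
  exact mul_ne_zero (Matrix.charpoly_monic _).ne_zero (Matrix.charpoly_monic _).ne_zero

/-- A graph without edges between two sets is on their union the disjoint sum of the two induced
graphs. -/
noncomputable def induceUnionIso (G : SimpleGraph V) {s t : Set V} (hd : Disjoint s t)
    (h : ∀ a ∈ s, ∀ b ∈ t, ¬ G.Adj a b) :
    G.induce s ⊕g G.induce t ≃g G.induce (s ∪ t) := by
  classical
  refine ⟨(Equiv.Set.union hd).symm, ?_⟩
  rintro (⟨a, ha⟩ | ⟨a, ha⟩) (⟨b, hb⟩ | ⟨b, hb⟩)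
  · simp
  · simpa using h a ha b hb
  · simpa using fun hab => h b hb a ha hab.symm
  · simp

lemma eigCount_induce_union [Finite V] (G : SimpleGraph V) {s t u : Set V} (hu : u = s ∪ t)
    (hd : Disjoint s t) (h : ∀ a ∈ s, ∀ b ∈ t, ¬ G.Adj a b) (x : ℝ) :
    (G.induce u).eigCount x = (G.induce s).eigCount x + (G.induce t).eigCount x := by
  subst hu
  rw [← (G.induceUnionIso hd h).eigCount_eq, eigCount_sum]

lemma eigCount_add_sigPos [Fintype V] [DecidableEq V] (G : SimpleGraph V) [DecidableRel G.Adj]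
    (x : ℝ) : G.eigCount x + sigPos (G.adjMatrix ℝ - x • 1).toQuadraticForm' = Fintype.card V := by
  rw [eigCount_eq_ncard]
  exact (G.isHermitian_adjMatrix ℝ).card_eigenvalues_le_add_sigPos x

/-- **Cauchy interlacing** for the deletion of one vertex. -/
lemma eigCount_induce_compl_le [Finite V] (G : SimpleGraph V) (r : V) (x : ℝ) :
    (G.induce {r}ᶜ).eigCount x ≤ G.eigCount x ∧
      G.eigCount x ≤ (G.induce {r}ᶜ).eigCount x + 1 := by
  classical
  have := Fintype.ofFinite V
  let f : (({r}ᶜ : Set V) → ℝ) →ₗ[ℝ] (V → ℝ) := Function.ExtendByZero.linearMap ℝ Subtype.val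
  have hfa : ∀ v (i : ({r}ᶜ : Set V)), f v i = v i := fun v i =>
    Subtype.val_injective.extend_apply _ _ _
  have hfr : ∀ v, f v r = 0 := fun v =>
    Function.extend_apply' _ _ _ (fun ⟨a, ha⟩ => a.2 ha)
  have hf : Function.Injective f := fun v w hvw => funext fun i => by
    rw [← hfa v, hvw, hfa]
  have hsum : ∀ g : V → ℝ, g r = 0 → ∑ i, g i = ∑ i : ({r}ᶜ : Set V), g i := fun g hg => by
    rw [← Finset.sum_subtype (Finset.univ.erase r) (by simp) g, Finset.sum_erase _ hg]
  -- A vector extended by zero does not see the row and column of `r`, so the form of `G` restricts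
  -- to that of `G` without `r`.
  have hQ : ∀ v, (G.adjMatrix ℝ - x • 1).toQuadraticForm' (f v) =
      ((G.induce {r}ᶜ).adjMatrix ℝ - x • 1).toQuadraticForm' v := by
    intro v
    simp only [Matrix.toQuadraticForm'_apply, dotProduct, Matrix.mulVec]
    rw [hsum _ (by simp [hfr])]
    refine Finset.sum_congr rfl fun i _ => ?_
    rw [hsum _ (by simp [hfr])]
    simp only [hfa]
    congr 1
    refine Finset.sum_congr rfl fun j _ => ?_
    congr 1
    simp [adjMatrix_apply, Matrix.one_apply, Subtype.ext_iff]
  -- Passing to complementary counts, `h1` gives the upper bound on the count of `G` and `h2` the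
  -- lower one.
  have h1 := sigPos_le_of_injective hf hQ
  have h2 := sigPos_add_finrank_le_of_injective hf hQ
  rw [Module.finrank_fintype_fun_eq_card, Module.finrank_fintype_fun_eq_card] at h2
  have h3 := G.eigCount_add_sigPos x
  have h4 := (G.induce {r}ᶜ).eigCount_add_sigPos x
  have h5 : Fintype.card ({r}ᶜ : Set V) + 1 = Fintype.card V := by
    have : 0 < Fintype.card V := Fintype.card_pos_iff.2 ⟨r⟩
    rw [Fintype.card_compl_set]
    simp
    lia
  lia

lemma eventually_eigCount_eq_zero [Finite V] (G : SimpleGraph V) :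
    ∀ᶠ x in atBot, G.eigCount x = 0 := by
  classical
  have := Fintype.ofFinite V
  have h : ∀ᶠ x in atBot, ∀ i, x < (G.isHermitian_adjMatrix ℝ).eigenvalues i :=
    eventually_all.2 fun i => eventually_lt_atBot _
  filter_upwards [h] with x hx
  rw [eigCount_eq_ncard, Set.ncard_eq_zero]
  ext i
  simpa using hx i

lemma eventually_eigCount_eq_card [Finite V] (G : SimpleGraph V) :
    ∀ᶠ x in atTop, G.eigCount x = Nat.card V := by
  classical
  have := Fintype.ofFinite V
  have h : ∀ᶠ x in atTop, ∀ i, (G.isHermitian_adjMatrix ℝ).eigenvalues i ≤ x :=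
    eventually_all.2 fun i => eventually_ge_atTop _
  filter_upwards [h] with x hx
  rw [eigCount_eq_ncard, ← Set.ncard_univ]
  congr 1
  ext i
  simpa using hx i

lemma eventually_eigCount_eq [Finite V] (G : SimpleGraph V) (x : ℝ) :
    ∀ᶠ y in 𝓝[≥] x, G.eigCount y = G.eigCount x := by
  classical
  have := Fintype.ofFinite V
  have h : ∀ᶠ y in 𝓝[≥] x, ∀ i, ((G.isHermitian_adjMatrix ℝ).eigenvalues i ≤ y ↔
      (G.isHermitian_adjMatrix ℝ).eigenvalues i ≤ x) := by
    refine eventually_all.2 fun i => ?_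
    rcases le_or_gt ((G.isHermitian_adjMatrix ℝ).eigenvalues i) x with hi | hi
    · filter_upwards [self_mem_nhdsWithin] with y hy
      exact ⟨fun _ => hi, fun _ => hi.trans hy⟩
    · filter_upwards [mem_nhdsWithin_of_mem_nhds (Iio_mem_nhds hi)] with y hy
      exact ⟨fun h => absurd h (not_le.2 hy), fun h => absurd h (not_le.2 hi)⟩
  filter_upwards [h] with y hy
  simp only [eigCount_eq_ncard, hy]

end SimpleGraph

/-! ### Eigenvalue counts of rooted trees -/

namespace SimpleGraph

variable {V W : Type*}

/-- The drop in the number of eigenvalues that are at most `x` when the vertex `r` is deleted. -/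
noncomputable def rootDefect [Finite V] (G : SimpleGraph V) (r : V) (x : ℝ) : ℕ :=
  G.eigCount x - (G.induce {r}ᶜ).eigCount x

lemma rootDefect_le_one [Finite V] (G : SimpleGraph V) (r : V) (x : ℝ) :
    G.rootDefect r x ≤ 1 := by
  have := G.eigCount_induce_compl_le r x
  unfold rootDefect
  lia

/-- By interlacing, the truncated subtraction in `rootDefect` is a true difference. -/
lemma eigCount_eq_add_rootDefect [Finite V] (G : SimpleGraph V) (r : V) (x : ℝ) :
    G.eigCount x = (G.induce {r}ᶜ).eigCount x + G.rootDefect r x := by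
  have := G.eigCount_induce_compl_le r x
  unfold rootDefect
  lia

lemma Iso.rootDefect_eq [Finite V] [Finite W] {G : SimpleGraph V} {H : SimpleGraph W} (e : G ≃g H)
    {r : V} {s : W} (hrs : e r = s) (x : ℝ) : G.rootDefect r x = H.rootDefect s x := by
  have hb : Set.BijOn e {r}ᶜ {s}ᶜ := by
    refine ⟨fun a ha h => ha (e.injective (h.trans hrs.symm)), e.injective.injOn, fun b hb => ?_⟩
    obtain ⟨a, rfl⟩ := e.surjective b
    exact ⟨a, fun h => hb (by rw [← hrs, Set.mem_singleton_iff.1 h]; rfl), rfl⟩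
  rw [rootDefect, rootDefect, e.eigCount_eq, (e.induce hb).eigCount_eq]

/-- Deleting a vertex from an induced graph gives an induced graph. -/
noncomputable def induceInduceComplIso (G : SimpleGraph V) (s : Set V) (u : s) :
    (G.induce s).induce {u}ᶜ ≃g G.induce (s \ {u.1}) where
  toFun a := ⟨a.1.1, a.1.2, fun h => a.2 (Subtype.ext h)⟩
  invFun a := ⟨⟨a.1, a.2.1⟩, fun h => a.2.2 (congrArg Subtype.val h)⟩
  left_inv _ := rfl
  right_inv _ := rfl
  map_rel_iff' := Iff.rfl

lemma eigCount_eq_zero_of_isEmpty [Finite V] [IsEmpty V] (G : SimpleGraph V) (x : ℝ) :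
    G.eigCount x = 0 := by
  classical
  have := Fintype.ofFinite V
  have := G.eigCount_add_sigPos x
  rw [Fintype.card_eq_zero] at this
  lia

lemma eventually_rootDefect_eq_zero [Finite V] (G : SimpleGraph V) (r : V) :
    ∀ᶠ x in atBot, G.rootDefect r x = 0 := by
  filter_upwards [G.eventually_eigCount_eq_zero] with x hx
  simp [rootDefect, hx]

lemma eventually_rootDefect_eq_one [Finite V] (G : SimpleGraph V) (r : V) :
    ∀ᶠ x in atTop, G.rootDefect r x = 1 := by
  filter_upwards [G.eventually_eigCount_eq_card, (G.induce {r}ᶜ).eventually_eigCount_eq_card]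
    with x hx hx'
  have h : Nat.card ({r} : Set V) + Nat.card ({r}ᶜ : Set V) = Nat.card V :=
    Set.ncard_add_ncard_compl {r}
  rw [Nat.card_unique] at h
  rw [rootDefect, hx, hx']
  lia

lemma eventually_rootDefect_eq [Finite V] (G : SimpleGraph V) (r : V) (x : ℝ) :
    ∀ᶠ y in 𝓝[≥] x, G.rootDefect r y = G.rootDefect r x := by
  filter_upwards [G.eventually_eigCount_eq x, (G.induce {r}ᶜ).eventually_eigCount_eq x]
    with y hy hy'
  rw [rootDefect, rootDefect, hy, hy']

end SimpleGraph

/-! ### Summing defects over the vertices of a tree -/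

namespace TreePath

variable {V : Type*} {G : SimpleGraph V}

lemma self_mem_hangingSet_zero (hG : G.IsTree) (r v : V) : v ∈ hangingSet hG r v 0 :=
  SimpleGraph.Walk.start_mem_support _

/-- The path from `v` to the root is a proper tail of the path from `u`. Depth thus strictly
increases towards descendants, which drives the induction below. -/
lemma length_toRoot_lt (hG : G.IsTree) (r : V) {u v : V} (h : u ∈ hangingSet hG r v 0)
    (hne : u ≠ v) : (toRoot hG r v).length < (toRoot hG r u).length := by
  obtain ⟨n, hn, hn'⟩ := SimpleGraph.Walk.mem_support_iff_exists_getVert.1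
    (show v ∈ (toRoot hG r u).support from h)
  have h1 : toRoot hG r v = ((toRoot hG r u).drop n).copy hn rfl := by
    subst hn
    exact toRoot_getVert hG r u n
  rw [h1, SimpleGraph.Walk.length_copy, SimpleGraph.Walk.drop_length]
  have : n ≠ 0 := by
    rintro rfl
    exact hne (by simpa using hn)
  lia

/-- Of two adjacent vertices, one is the parent of the other. -/
lemma support_toRoot_of_adj (hG : G.IsTree) (r : V) {a b : V} (hab : G.Adj a b) :
    (toRoot hG r b).support = b :: (toRoot hG r a).support ∨
      (toRoot hG r a).support = a :: (toRoot hG r b).support := by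
  have key : ∀ {a b : V} (hab : G.Adj a b), b ∉ (toRoot hG r a).support →
      (toRoot hG r b).support = b :: (toRoot hG r a).support := by
    intro a b hab hb
    rw [← eq_toRoot hG r b ((SimpleGraph.Walk.cons_isPath_iff hab.symm _).2
      ⟨toRoot_isPath hG r a, hb⟩), SimpleGraph.Walk.support_cons]
  by_cases hb : b ∈ (toRoot hG r a).support
  · refine Or.inr (key hab.symm fun ha => ?_)
    have h1 := length_toRoot_lt hG r (show a ∈ hangingSet hG r b 0 from hb) hab.ne
    have h2 := length_toRoot_lt hG r (show b ∈ hangingSet hG r a 0 from ha) hab.ne'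
    lia
  · exact Or.inl (key hab hb)

/-- The eigenvalue count of a descendant-closed part of a rooted tree is the sum over its vertices of
the defects of the subtrees of descendants. -/
lemma eigCount_induce_eq_sum [Finite V] (hG : G.IsTree) (r : V) (x : ℝ) (W : Finset V)
    (hW : ∀ u ∈ W, hangingSet hG r u 0 ⊆ W) :
    (G.induce (W : Set V)).eigCount x = ∑ u ∈ W, (G.induce (hangingSet hG r u 0)).rootDefect
      ⟨u, self_mem_hangingSet_zero hG r u⟩ x := by
  classical
  induction W using Finset.strongInduction with
  | H W ih =>
  rcases W.eq_empty_or_nonempty with rfl | hne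
  · have : IsEmpty ((∅ : Finset V) : Set V) := by simp
    rw [Finset.sum_empty, SimpleGraph.eigCount_eq_zero_of_isEmpty]
  -- The induction removes a vertex `u` of least depth. No other vertex of `W` has `u` as a
  -- descendant, so `W` without `u` is still closed under descendants, although it may be a forest.
  obtain ⟨u, huW, hmin⟩ := W.exists_min_image (fun u => (toRoot hG r u).length) hne
  have htop : ∀ w ∈ W, u ∈ hangingSet hG r w 0 → w = u := by
    intro w hw huw
    by_contra hwu
    exact absurd (hmin w hw) (not_le.2 (length_toRoot_lt hG r huw (Ne.symm hwu)))
  set D := hangingSet hG r u 0 with hD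
  have huD : u ∈ D := self_mem_hangingSet_zero hG r u
  have hclosed : ∀ w ∈ W.erase u, hangingSet hG r w 0 ⊆ (W.erase u : Finset V) := by
    intro w hw a ha
    obtain ⟨hwu, hwW⟩ := Finset.mem_erase.1 hw
    refine Finset.mem_coe.2 (Finset.mem_erase.2 ⟨?_, hW w hwW ha⟩)
    rintro rfl
    exact hwu (htop w hwW ha)
  -- Only the edge from `u` to its parent leaves `D`, and by minimality that parent is not in `W`.
  have hsep : ∀ a ∈ D, ∀ b ∈ (W : Set V) \ D, ¬ G.Adj a b := by
    intro a ha b hb hab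
    have ha' : u ∈ (toRoot hG r a).support := ha
    rcases support_toRoot_of_adj hG r hab with h | h
    · refine hb.2 (show u ∈ (toRoot hG r b).support from ?_)
      rw [h]
      exact List.mem_cons_of_mem _ ha'
    · rw [h, List.mem_cons] at ha'
      rcases ha' with rfl | ha'
      · have hub : u ∈ hangingSet hG r b 0 := by
          change b ∈ (toRoot hG r u).support
          rw [h]
          exact List.mem_cons_of_mem _ (SimpleGraph.Walk.start_mem_support _)
        exact hab.ne (htop b hb.1 hub).symm
      · exact hb.2 ha'
  have h1 : (W : Set V) = D ∪ ((W : Set V) \ D) :=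
    (Set.union_sdiff_cancel (hW u huW)).symm
  have h2 : ((W.erase u : Finset V) : Set V) = (D \ {u}) ∪ ((W : Set V) \ D) := by
    ext a
    by_cases ha : a = u
    · simp [ha, huD]
    · by_cases haD : a ∈ D
      · simpa [ha, haD] using hW u huW haD
      · simp [ha, haD]
  have h3 := G.eigCount_induce_union h1 Set.disjoint_sdiff_right hsep x
  have h4 := G.eigCount_induce_union h2 (Set.disjoint_sdiff_right.mono_left Set.sdiff_subset)
    (fun a ha => hsep a ha.1) x
  -- `W` and `W` without `u` share the part outside `D`; their counts differ by the defect of `D` at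
  -- `u`.
  rw [← Finset.add_sum_erase _ _ huW, ← ih _ (Finset.erase_ssubset huW) hclosed, h3, h4,
    (G.induce D).eigCount_eq_add_rootDefect ⟨u, huD⟩,
    (G.induceInduceComplIso D ⟨u, huD⟩).eigCount_eq]
  ring

/-- The eigenvalue count of a rooted tree is the sum over its vertices of the defects of the subtrees
of descendants. -/
lemma eigCount_eq_sum [Fintype V] (hG : G.IsTree) (r : V) (x : ℝ) :
    G.eigCount x = ∑ u, (G.induce (hangingSet hG r u 0)).rootDefect
      ⟨u, self_mem_hangingSet_zero hG r u⟩ x := by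
  rw [← eigCount_induce_eq_sum hG r x Finset.univ (by simp)]
  refine SimpleGraph.Iso.eigCount_eq ?_ x
  rw [Finset.coe_univ]
  exact (SimpleGraph.induceUnivIso G).symm

end TreePath

/-! ### The defect as a function of unlabeled trees -/

namespace UTree

/-- The drop in the number of eigenvalues that are at most `x` when the root is deleted. -/
noncomputable def rootDefect (t : UTree) (x : ℝ) : ℕ :=
  Quotient.lift (s := LabeledRootedTree.setoid) (fun t : LabeledRootedTree => t.graph.rootDefect t.root x)
    (fun _ _ h => let ⟨e, he⟩ := (h : LabeledRootedTree.Isom _ _); e.rootDefect_eq he x) t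

lemma rootDefect_ofGraph {V : Type*} [Fintype V] (G : SimpleGraph V) (hG : G.IsTree) (r : V)
    (x : ℝ) : (ofGraph G hG r).rootDefect x = G.rootDefect r x :=
  ((G.overFinIso rfl).rootDefect_eq rfl x).symm

lemma eventually_rootDefect_eq_zero (t : UTree) : ∀ᶠ x in atBot, t.rootDefect x = 0 := by
  induction t using Quotient.inductionOn with
  | h t => exact t.graph.eventually_rootDefect_eq_zero t.root

lemma eventually_rootDefect_eq_one (t : UTree) : ∀ᶠ x in atTop, t.rootDefect x = 1 := by
  induction t using Quotient.inductionOn with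
  | h t => exact t.graph.eventually_rootDefect_eq_one t.root

lemma eventually_rootDefect_eq (t : UTree) (x : ℝ) :
    ∀ᶠ y in 𝓝[≥] x, t.rootDefect y = t.rootDefect x := by
  induction t using Quotient.inductionOn with
  | h t => exact t.graph.eventually_rootDefect_eq t.root x

end UTree

/-! ### Convergence of spectral distributions -/

open Set in
/-- Pointwise convergence of distribution functions implies weak convergence. -/
lemma tendsto_probabilityMeasure_of_tendsto_Iic {ι : Type*} {l : Filter ι}
    [l.IsCountablyGenerated] {μ : ι → ProbabilityMeasure ℝ} {ν : ProbabilityMeasure ℝ}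
    (h : ∀ x, Tendsto (fun i => (μ i : Measure ℝ).real (Iic x)) l
      (𝓝 ((ν : Measure ℝ).real (Iic x)))) : Tendsto μ l (𝓝 ν) := by
  -- Half-open intervals form a π-system containing small neighbourhoods of each point. As
  -- convergence is assumed at every `x`, their masses converge without any condition on atoms.
  refine (isPiSystem_Ioc (id : ℝ → ℝ) id).tendsto_probabilityMeasure_of_tendsto_of_mem ?_ ?_ ?_
  · rintro _ ⟨a, b, -, rfl⟩
    exact measurableSet_Ioc
  · intro u hu x hx
    obtain ⟨ε, hε, hu'⟩ := Metric.isOpen_iff.1 hu x hx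
    refine ⟨Ioc (x - ε / 2) (x + ε / 2), ⟨_, _, by simp only [id]; linarith, rfl⟩,
      Ioc_mem_nhds (by linarith) (by linarith), fun y hy => hu' ?_⟩
    rw [Metric.mem_ball, Real.dist_eq, abs_lt]
    constructor <;> linarith [hy.1, hy.2]
  · rintro _ ⟨a, b, hab, rfl⟩
    have key : ∀ ρ : ProbabilityMeasure ℝ, ((ρ (Ioc a b) : NNReal) : ℝ) =
        (ρ : Measure ℝ).real (Iic b) - (ρ : Measure ℝ).real (Iic a) := by
      intro ρ
      rw [← Iic_sdiff_Iic]
      exact measureReal_sdiff (μ := (ρ : Measure ℝ)) (Iic_subset_Iic.2 hab.le) measurableSet_Iic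
    rw [← NNReal.tendsto_coe]
    simp only [id, key]
    exact (h b).sub (h a)

/-- Convergence in distribution to a constant passes to random elements that are close to a constant
whenever the original ones are. -/
lemma MeasureTheory.TendstoInDistribution.of_forall_nhds_const {X Y : Type*} [TopologicalSpace X]
    [MeasurableSpace X] [BorelSpace X] [HasOuterApproxClosed X] [TopologicalSpace Y]
    [MeasurableSpace Y] [BorelSpace Y] {Ω : ℕ → Type*} [∀ n, MeasurableSpace (Ω n)]
    {P : ∀ n, Measure (Ω n)} [∀ n, IsProbabilityMeasure (P n)] {f : ∀ n, Ω n → X}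
    {g : ∀ n, Ω n → Y} {c : X} {d : Y}
    (hf : TendstoInDistribution f atTop (fun _ : Unit => c) P (Measure.dirac ()))
    (hg : ∀ n, AEMeasurable (g n) (P n))
    (h : ∀ U ∈ 𝓝 d, ∃ V ∈ 𝓝 c, ∀ n ω, f n ω ∈ V → g n ω ∈ U) :
    TendstoInDistribution g atTop (fun _ : Unit => d) P (Measure.dirac ()) := by
  -- Portmanteau for open sets: the limit law is a point mass, so only open sets containing `d` need
  -- an argument.
  refine ⟨hg, by fun_prop, tendsto_of_forall_isOpen_le_liminf' fun U hU => ?_⟩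
  by_cases hd : d ∈ U
  · obtain ⟨V, hV, hVU⟩ := h U (hU.mem_nhds hd)
    obtain ⟨V', hV'V, hV', hc⟩ := mem_nhds_iff.1 hV
    have h1 := ProbabilityMeasure.le_liminf_measure_open_of_tendsto hf.tendsto hV'
    simp only [ProbabilityMeasure.coe_mk, Measure.map_const, measure_univ, one_smul] at h1 ⊢
    rw [Measure.dirac_apply' _ hV'.measurableSet, Set.indicator_of_mem hc] at h1
    rw [Measure.dirac_apply' _ hU.measurableSet, Set.indicator_of_mem hd]
    refine h1.trans (liminf_le_liminf (Eventually.of_forall fun n => ?_))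
    rw [Measure.map_apply_of_aemeasurable (hf.forall_aemeasurable n) hV'.measurableSet,
      Measure.map_apply_of_aemeasurable (hg n) hU.measurableSet]
    exact measure_mono fun ω hω => hVU n ω (hV'V hω)
  · simp only [ProbabilityMeasure.coe_mk, Measure.map_const, measure_univ, one_smul]
    rw [Measure.dirac_apply' _ hU.measurableSet, Set.indicator_of_notMem hd]
    exact zero_le

lemma empiricalDist_apply {ι X : Type*} [Fintype ι] [Nonempty ι] [MeasurableSpace X] (f : ι → X)
    {A : Set X} (hA : MeasurableSet A) :
    (empiricalDist f : Measure X) A = (Fintype.card ι : ℝ≥0∞)⁻¹ * ({i | f i ∈ A}.ncard : ℝ≥0∞) := by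
  classical
  change ((Fintype.card ι : ℝ≥0∞)⁻¹ • ∑ i, Measure.dirac (f i)) A = _
  rw [Measure.smul_apply, smul_eq_mul, Measure.finsetSum_apply]
  congr 1
  simp only [Measure.dirac_apply' _ hA, Set.indicator_apply, Pi.one_apply]
  rw [Finset.sum_boole, Set.ncard_eq_toFinset_card']
  congr 2
  ext i
  simp

/-- The sequences whose first entry is a tree that loses an eigenvalue in `(-∞, x]` when its root is
deleted. -/
def rootDefectSet (x : ℝ) : Set (ℕ → UTreeStar) :=
  {s | ∃ t, s 0 = UTreeStar.ofUTree t ∧ t.rootDefect x = 1}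

/-- Membership depends on one coordinate in a discrete space. The empty boundary makes its mass
continuous under weak convergence. -/
lemma isClopen_rootDefectSet (x : ℝ) : IsClopen (rootDefectSet x) :=
  (isClopen_discrete {a | ∃ t, a = UTreeStar.ofUTree t ∧ t.rootDefect x = 1}).preimage
    (continuous_apply 0)

lemma measurableSet_rootDefectSet (x : ℝ) : MeasurableSet (rootDefectSet x) :=
  measurable_pi_apply (X := fun _ : ℕ => UTreeStar) 0
    (MeasurableSet.of_discrete (s := {a | ∃ t, a = UTreeStar.ofUTree t ∧ t.rootDefect x = 1}))

lemma mem_rootDefectSet_iff {s : ℕ → UTreeStar} {t : UTree} (h : s 0 = UTreeStar.ofUTree t)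
    (x : ℝ) : s ∈ rootDefectSet x ↔ t.rootDefect x = 1 := by
  constructor
  · rintro ⟨t', h1, h2⟩
    have : t = t' := Option.some_injective _ (h.symm.trans h1)
    exact this ▸ h2
  · exact fun h' => ⟨t, h, h'⟩

lemma LabeledRootedTree.spectralDist_Iic (t : LabeledRootedTree) (x : ℝ) :
    (t.spectralDist : Measure ℝ) (Set.Iic x) = (t.fringeDist : Measure _) (rootDefectSet x) := by
  classical
  rw [spectralDist, fringeDist, empiricalDist_apply _ measurableSet_Iic,
    empiricalDist_apply _ (measurableSet_rootDefectSet x)]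
  congr 2
  refine (t.graph.eigCount_eq_ncard x).symm.trans ?_
  rw [TreePath.eigCount_eq_sum t.isTree t.root x, Set.ncard_eq_toFinset_card', Finset.card_eq_sum_ones,
    Set.toFinset_ofPred, Finset.sum_filter]
  refine Finset.sum_congr rfl fun v _ => ?_
  have h0 : TreePath.fringe t.isTree t.root v 0 = UTreeStar.ofUTree (UTree.ofGraph
      (t.graph.induce (TreePath.hangingSet t.isTree t.root v 0))
      (TreePath.hangingSet_isTree t.isTree t.root v (Nat.zero_le _))
      ⟨v, TreePath.self_mem_hangingSet_zero t.isTree t.root v⟩) := by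
    simp [TreePath.fringe]
  rw [if_congr (mem_rootDefectSet_iff h0 x) rfl rfl, UTree.rootDefect_ofGraph]
  -- Each defect is 0 or 1, so the sum of the defects counts the vertices of defect 1.
  have := (t.graph.induce (TreePath.hangingSet t.isTree t.root v 0)).rootDefect_le_one
    ⟨v, TreePath.self_mem_hangingSet_zero t.isTree t.root v⟩ x
  split_ifs <;> lia

/-- The distribution function of the spectral distribution is a functional of the fringe
distribution. -/
lemma UTree.spectralDist_Iic (t : UTree) (x : ℝ) :
    (t.spectralDist : Measure ℝ) (Set.Iic x) = (t.fringeDist : Measure _) (rootDefectSet x) := by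
  induction t using Quotient.inductionOn with
  | h t => exact t.spectralDist_Iic x

/-- The spectral distribution is determined in the limit by the limit of the fringe distribution. -/
theorem exists_tendsto_spectralDist (μ : ProbabilityMeasure (ℕ → UTreeStar))
    (hμ : ∀ᵐ s ∂(μ : Measure (ℕ → UTreeStar)), ∃ t, s 0 = UTreeStar.ofUTree t) :
    ∃ F, Tendsto UTree.spectralDist (comap UTree.fringeDist (𝓝 μ)) (𝓝 F) := by
  -- If `μ` is not a limit of fringe laws, any `F` serves. Otherwise the filter is nontrivial, as
  -- the passage to the limit in inequalities requires.
  rcases (comap UTree.fringeDist (𝓝 μ)).eq_or_neBot with hbot | hne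
  · exact ⟨⟨Measure.dirac 0, inferInstance⟩, by rw [hbot]; exact tendsto_bot⟩
  have hreal : ∀ (t : UTree) x, (t.spectralDist : Measure ℝ).real (Set.Iic x) =
      (t.fringeDist : Measure _).real (rootDefectSet x) := fun t x => by
    rw [measureReal_def, UTree.spectralDist_Iic, ← measureReal_def]
  have hlim : ∀ x, Tendsto (fun t : UTree => (t.spectralDist : Measure ℝ).real (Set.Iic x))
      (comap UTree.fringeDist (𝓝 μ)) (𝓝 ((μ : Measure _).real (rootDefectSet x))) := by
    intro x
    simp only [hreal]
    have h := ProbabilityMeasure.tendsto_measure_of_isClopen_of_tendsto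
      (tendsto_comap (f := UTree.fringeDist) (x := 𝓝 μ)) (isClopen_rootDefectSet x)
    exact (NNReal.tendsto_coe.2 h)
  -- Dominated convergence of indicators, used with `A` the event at `x`, the empty set and the
  -- whole space.
  have hcont : ∀ {l : Filter ℝ} [l.IsCountablyGenerated] {A : Set (ℕ → UTreeStar)},
      MeasurableSet A → (∀ s t, s 0 = UTreeStar.ofUTree t →
        ∀ᶠ y in l, s ∈ rootDefectSet y ↔ s ∈ A) →
      Tendsto (fun y => (μ : Measure _).real (rootDefectSet y)) l
        (𝓝 ((μ : Measure _).real A)) := by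
    intro l _ A hA h
    refine (ENNReal.tendsto_toReal (measure_ne_top _ _)).comp
      (tendsto_measure_of_ae_tendsto_indicator_of_isFiniteMeasure l hA
        measurableSet_rootDefectSet ?_)
    filter_upwards [hμ] with s hs
    obtain ⟨t, ht⟩ := hs
    exact h s t ht
  let f : StieltjesFunction ℝ :=
    { toFun := fun x => (μ : Measure (ℕ → UTreeStar)).real (rootDefectSet x)
      -- The defect of a single tree need not be monotone in `x`; monotonicity is inherited from the
      -- spectral distribution functions.
      mono' := fun x y hxy => le_of_tendsto_of_tendsto' (hlim x) (hlim y) fun t =>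
        measureReal_mono (Set.Iic_subset_Iic.2 hxy)
      right_continuous' := fun x => hcont (l := 𝓝[≥] x) (measurableSet_rootDefectSet x) fun s t hs => by
        filter_upwards [t.eventually_rootDefect_eq x] with y hy
        rw [mem_rootDefectSet_iff hs, mem_rootDefectSet_iff hs, hy] }
  have hf0 : Tendsto f atBot (𝓝 0) := by
    have := hcont (l := atBot) MeasurableSet.empty fun s t hs => by
      filter_upwards [t.eventually_rootDefect_eq_zero] with y hy
      simp [mem_rootDefectSet_iff hs, hy]
    simpa only [measureReal_empty] using this
  have hf1 : Tendsto f atTop (𝓝 1) := by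
    have := hcont (l := atTop) MeasurableSet.univ fun s t hs => by
      filter_upwards [t.eventually_rootDefect_eq_one] with y hy
      simp [mem_rootDefectSet_iff hs, hy]
    simpa only [probReal_univ] using this
  refine ⟨⟨f.measure, f.isProbabilityMeasure hf0 hf1⟩,
    tendsto_probabilityMeasure_of_tendsto_Iic fun x => ?_⟩
  have : f.measure.real (Set.Iic x) = (μ : Measure _).real (rootDefectSet x) := by
    rw [measureReal_def, f.measure_Iic hf0, sub_zero]
    exact ENNReal.toReal_ofReal measureReal_nonneg
  simpa only [ProbabilityMeasure.coe_mk, this] using hlim x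

theorem theorem4p1 {Ω : ℕ → Type*} [∀ n, MeasurableSpace (Ω n)]
    (P : ∀ n, Measure (Ω n)) [∀ n, IsProbabilityMeasure (P n)]
    (T : ∀ n, Ω n → UTree) (hT : ∀ n, Measurable (T n))
    {Ω' : Type*} [MeasurableSpace Ω'] (P' : Measure Ω') [IsProbabilityMeasure P']
    (S : Ω' → ℕ → UTree) (hS : Measurable S)
    (hconv : ConvergesInFringe P T P' S hS) :
    ∃ F : ProbabilityMeasure ℝ,
      ConvergesInDistributionTo P (fun n ω => (T n ω).spectralDist) F := by
  obtain ⟨F, hF⟩ := exists_tendsto_spectralDist (sinTreeLaw P' S hS) <| by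
    have hmeas : Measurable fun ω k => UTreeStar.ofUTree (S ω k) := measurable_pi_lambda _ fun k =>
      (measurable_of_countable UTreeStar.ofUTree).comp ((measurable_pi_apply k).comp hS)
    exact ae_map_iff hmeas.aemeasurable
      (measurable_pi_apply 0 (MeasurableSet.of_discrete
        (s := {a | ∃ t, a = UTreeStar.ofUTree t}))) |>.2 (ae_of_all _ fun ω => ⟨S ω 0, rfl⟩)
  let _ : MeasurableSpace (ProbabilityMeasure ℝ) := borel _
  have : BorelSpace (ProbabilityMeasure ℝ) := ⟨rfl⟩
  let _ : MeasurableSpace (ProbabilityMeasure (ℕ → UTreeStar)) := borel _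
  have : BorelSpace (ProbabilityMeasure (ℕ → UTreeStar)) := ⟨rfl⟩
  refine ⟨F, TendstoInDistribution.of_forall_nhds_const (f := fun n ω => (T n ω).fringeDist)
    (c := sinTreeLaw P' S hS) hconv
    (fun n => ((measurable_of_countable UTree.spectralDist).comp (hT n)).aemeasurable)
    fun U hU => ?_⟩
  -- A neighbourhood of the limiting fringe law that forces the spectral distribution into `U`,
  -- uniformly over all trees.
  obtain ⟨V, hV, hVU⟩ := mem_comap.1 (hF hU)
  exact ⟨V, hV, fun n ω h => hVU h⟩
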